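/- Let $n\ge 1$ be an integer, let $S^n$ be the unit sphere of $\mathbb{R}^{n+1}$ and let $\mathbb{R}_+$ be the set of positive real numbers. Let $\mathrm{inv}$ be the map of $\mathbb{R}^{n+1}\setminus\{0\}$ given in polar coordinates $(\theta,r)$ (denoting the point $r\theta$) by $\mathrm{inv}(\theta,r)=(-\theta,1/r)$, and for $\gamma:S^n\to\mathbb{R}_+$ put $\mathrm{graph}(\gamma)=\{\gamma(\theta)\theta : \theta\in S^n\}$. A continuous function $\gamma:S^n\to\mathbb{R}_+$ is a *convex integrand* if the boundary of the convex hull of $\mathrm{inv}(\mathrm{graph}(\gamma))$ is $\mathrm{inv}(\mathrm{graph}(\gamma))$. The *dual* of a convex integrand $\gamma$ is the convex integrand $\delta$ with $\mathrm{inv}(\mathrm{graph}(\delta))=\partial\mathcal{W}_\gamma$, where $\mathcal{W}_\gamma=\bigcap_{\theta\in S^n}\{x\in\mathbb{R}^{n+1} : x\cdot\theta\le\gamma(\theta)\}$. A $C^\infty$ function $\gamma:S^n\to\mathbb{R}_+$ is *stable* if the set of all $H\circ\gamma\circ h^{-1}$, with $h:S^n\to S^n$ and $H:\mathbb{R}_+\to\mathbb{R}_+$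 $C^\infty$ diffeomorphisms, is open in $C^\infty(S^n,\mathbb{R}_+)$ for the Whitney $C^\infty$ topology. Let $\gamma:S^n\to\mathbb{R}_+$ be a stable convex integrand whose dual convex integrand $\delta:S^n\to\mathbb{R}_+$ is of class $C^\infty$, and put $\widehat{\gamma}(\theta)=1/\gamma(-\theta)$ and $\widehat{\delta}(\theta)=1/\delta(-\theta)$. Let $\theta_0\in S^n$ and let $i$ be an integer with $0\le i\le n$. Then the following are equivalent: 1. $\theta_0$ is a non-degenerate critical point of $\gamma$ with Morse index $i$; 2. $-\theta_0$ is a non-degenerate critical point of $\delta$ with Morse index $n-i$; 3. $-\theta_0$ is a non-degenerate critical point of $\widehat{\gamma}$ with Morse index $n-i$; 4. $\theta_0$ is a non-degenerate critical point of $\widehat{\delta}$ with Morse index $i$. -/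

import Mathlib

open scoped Manifold ContDiff Topology

noncomputable section

/-- The Euclidean space `ℝ^{n+1}`. -/
abbrev Euc (n : ℕ) : Type := EuclideanSpace ℝ (Fin (n + 1))

instance factFinrankEuc (n : ℕ) : Fact (Module.finrank ℝ (Euc n) = n + 1) :=
  ⟨by simp⟩

/-- The unit sphere `S^n` of `ℝ^{n+1}`, with Mathlib's smooth manifold structure. -/
abbrev Sph (n : ℕ) : Type := Metric.sphere (0 : Euc n) 1

/-- `f : S^n → ℝ` is of class `C^∞`. -/
def SmoothOnSph {n : ℕ} (f : Sph n → ℝ) : Prop :=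
  ContMDiff (𝓡 n) 𝓘(ℝ, ℝ) ∞ f

/-- The inversion `(θ, r) ↦ (-θ, 1 / r)` in polar coordinates `x = r θ`, that is
`r = ‖x‖`, `θ = x / ‖x‖`; only its values at `x ≠ 0` are used. -/
def polarInv {n : ℕ} (x : Euc n) : Euc n :=
  (1 / ‖x‖) • (-((1 / ‖x‖) • x))

/-- The graph of `γ` in polar coordinates: the points `γ(θ) θ`. -/
def polarGraph {n : ℕ} (γ : Sph n → ℝ) : Set (Euc n) :=
  Set.range fun θ : Sph n => γ θ • (θ : Euc n)

/-- A continuous function `γ : S^n → ℝ_+` is a convex integrand if the boundary of the convex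
hull of `inv(graph γ)` is equal to `inv(graph γ)`. -/
structure IsConvexIntegrand {n : ℕ} (γ : Sph n → ℝ) : Prop where
  continuous : Continuous γ
  pos : ∀ θ, 0 < γ θ
  frontier_eq :
    frontier (convexHull ℝ (polarInv '' polarGraph γ)) = polarInv '' polarGraph γ

/-- The Wulff shape associated with `γ`. -/
def wulffShape {n : ℕ} (γ : Sph n → ℝ) : Set (Euc n) :=
  ⋂ θ : Sph n, {x : Euc n | inner ℝ x (θ : Euc n) ≤ γ θ}

/-- `δ` is the dual convex integrand of `γ`. -/
structure IsDualIntegrand {n : ℕ} (γ δ : Sph n → ℝ) : Prop where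
  isConvexIntegrand : IsConvexIntegrand δ
  inv_graph_eq : polarInv '' polarGraph δ = frontier (wulffShape γ)

/-- The function `θ ↦ 1 / γ(-θ)`. -/
def hatFun {n : ℕ} (γ : Sph n → ℝ) : Sph n → ℝ := fun θ => 1 / γ (-θ)

/-- The set `C^∞(S^n, ℝ_+)`. -/
abbrev SmoothPos (n : ℕ) : Type :=
  {f : Sph n → ℝ // SmoothOnSph f ∧ ∀ θ, 0 < f θ}

/-- The set `ℝ_+` of positive reals, as an open submanifold of `ℝ`. -/
abbrev PosReal : TopologicalSpace.Opens ℝ := ⟨Set.Ioi 0, isOpen_Ioi⟩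

/-- Basic neighbourhood of `f` for the Whitney topology: all `g` whose partial derivatives of
order at most `r` in the chart `φ` are `ε`-close to those of `f` on the set `K`. -/
def whitneyNhd {n : ℕ} (f : SmoothPos n)
    (φ : OpenPartialHomeomorph (Sph n) (EuclideanSpace ℝ (Fin n)))
    (K : Set (Sph n)) (r : ℕ) (ε : ℝ) : Set (SmoothPos n) :=
  {g | ∀ θ ∈ K, ∀ k ≤ r,
    ‖iteratedFDeriv ℝ k (g.1 ∘ φ.symm) (φ θ) - iteratedFDeriv ℝ k (f.1 ∘ φ.symm) (φ θ)‖ < ε}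

/-- The Whitney `C^∞` topology on `C^∞(S^n, ℝ_+)`. As `S^n` is compact, it is generated by the
sets `whitneyNhd f φ K r ε`, where `φ` runs through the smooth charts of `S^n`, `K` through the
compact subsets of the domain of `φ`, `r` through `ℕ` and `ε` through the positive reals. -/
abbrev whitneyTopology (n : ℕ) : TopologicalSpace (SmoothPos n) :=
  TopologicalSpace.generateFrom
    {U | ∃ (f : SmoothPos n) (φ : OpenPartialHomeomorph (Sph n) (EuclideanSpace ℝ (Fin n)))
        (K : Set (Sph n)) (r : ℕ) (ε : ℝ),
        φ ∈ IsManifold.maximalAtlas (𝓡 n) ∞ (Sph n) ∧ IsCompact K ∧ K ⊆ φ.source ∧ 0 < ε ∧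
        U = whitneyNhd f φ K r ε}

/-- `𝒜`-equivalence: `γ₁ = H ∘ γ₂ ∘ h⁻¹` for `C^∞` diffeomorphisms `h` of `S^n` and
`H` of `ℝ_+`. -/
def AEquivalent {n : ℕ} (γ₁ γ₂ : SmoothPos n) : Prop :=
  ∃ (h : Diffeomorph (𝓡 n) (𝓡 n) (Sph n) (Sph n) ∞)
    (H : Diffeomorph 𝓘(ℝ, ℝ) 𝓘(ℝ, ℝ) PosReal PosReal ∞),
    ∀ θ : Sph n, γ₁.1 θ = (H ⟨γ₂.1 (h.symm θ), γ₂.2.2 (h.symm θ)⟩ : ℝ)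

/-- `γ` is stable: it belongs to `C^∞(S^n, ℝ_+)` and its `𝒜`-equivalence class is open there. -/
def IsStable {n : ℕ} (γ : Sph n → ℝ) : Prop :=
  ∃ h : SmoothOnSph γ ∧ ∀ θ, 0 < γ θ,
    IsOpen[whitneyTopology n] {g : SmoothPos n | AEquivalent g ⟨γ, h⟩}

/-- The Hessian of `f` at `θ` in the coordinates of the preferred chart at `θ`. At a critical
point, its rank and signature do not depend on the chart. -/
def hessianAt {n : ℕ} (f : Sph n → ℝ) (θ : Sph n) (v w : EuclideanSpace ℝ (Fin n)) : ℝ :=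
  fderiv ℝ (fderiv ℝ (f ∘ (chartAt (EuclideanSpace ℝ (Fin n)) θ).symm))
    (chartAt (EuclideanSpace ℝ (Fin n)) θ θ) v w

/-- `θ` is a non-degenerate critical point of `f`, with Morse index `i`: the differential of `f`
vanishes at `θ`, the Hessian of `f` at `θ` is non-degenerate, and `i` is the maximal dimension
of a subspace on which the Hessian is negative definite. -/
structure IsNondegCritWithIndex {n : ℕ} (f : Sph n → ℝ) (θ : Sph n) (i : ℕ) : Prop where
  smoothAt : ContMDiffAt (𝓡 n) 𝓘(ℝ, ℝ) ∞ f θ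
  critical : mfderiv (𝓡 n) 𝓘(ℝ, ℝ) f θ = 0
  nondegenerate : ∀ v, (∀ w, hessianAt f θ v w = 0) → v = 0
  index : IsGreatest {d : ℕ | ∃ W : Submodule ℝ (EuclideanSpace ℝ (Fin n)),
    Module.finrank ℝ W = d ∧ ∀ v ∈ W, v ≠ 0 → hessianAt f θ v v < 0} i

end

/-! Let `W` be the Wulff shape of `γ`. Convexity of `γ` says that `h(x) = ‖x‖ γ(x/‖x‖)` is the
support function of `W`, and duality says that `j(x) = ‖x‖ δ(-x/‖x‖)` is its gauge. Hence `⟪x, u⟫ ≤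
j(x) h(u)`, and every nonzero `x` and every nonzero `u` has a partner giving equality
(`IsDualIntegrand.dualPair`). First-order conditions at equality show that the gradients of `h` and
`j` are mutually inverse up to scaling, and differentiating this at a critical direction `θ` makes
the two Hessians inverse to each other on `θᗮ` (`DualPair.fderiv_fderiv_gradient`).

Put `P = hatFun δ` and `ρ = γ(θ) = P(θ)`, and let `B`, `B'` be the Hessians of `γ`, `P` on `θᗮ`.
Then `h` has Hessian `ρ + B` there and `j = ‖x‖ / P` has Hessian `ρ⁻¹ - ρ⁻² B'`. In eigenvalues, `b'
= ρ b / (ρ + b)`; as `ρ + b > 0`, the signs agree, so `B` and `B'` have the same index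
(`nondegWithIndex_iff_of_inverse`). This is 1 ↔ 4.

The equivalences 1 ↔ 3 and 2 ↔ 4 are elementary: at a critical point, passing to `1 / f(-θ)`
multiplies the Hessian by a negative number, which turns index `i` into `n - i`
(`isNondegCritWithIndex_hatFun_iff`). -/

noncomputable section

/-- A bilinear form is non-degenerate and `i` is the maximal dimension of a subspace on which it is
negative definite. -/
def NondegWithIndex {V : Type*} [AddCommGroup V] [Module ℝ V] (B : LinearMap.BilinForm ℝ V)
    (i : ℕ) : Prop :=
  (∀ v, (∀ w, B v w = 0) → v = 0) ∧
    IsGreatest {d : ℕ | ∃ W : Submodule ℝ V,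
      Module.finrank ℝ W = d ∧ ∀ v ∈ W, v ≠ 0 → B v v < 0} i

/-! ### Index of a symmetric bilinear form: change of coordinates and of sign. -/

section LinearAlgebra

variable {V V' : Type*} [AddCommGroup V] [Module ℝ V] [AddCommGroup V'] [Module ℝ V']

theorem NondegWithIndex.of_equiv {B : LinearMap.BilinForm ℝ V} {B' : LinearMap.BilinForm ℝ V'}
    (e : V ≃ₗ[ℝ] V') {c : ℝ} (hc : 0 < c) (h : ∀ v w, B v w = c * B' (e v) (e w)) {i : ℕ}
    (hB : NondegWithIndex B i) : NondegWithIndex B' i := by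
  have h' : ∀ v w, B (e.symm v) (e.symm w) = c * B' v w := fun v w => by simp [h]
  refine ⟨fun v hv => ?_, ?_, ?_⟩
  · have := hB.1 (e.symm v) fun w => by rw [h]; simp [hv]
    simpa using this
  · obtain ⟨W, hW, hneg⟩ := hB.2.1
    refine ⟨W.map e.toLinearMap, by rw [← hW]; exact e.finrank_map_eq W, ?_⟩
    rintro _ ⟨v, hv, rfl⟩ hne
    have h1 := hneg v hv (fun h0 => hne (by simp [h0]))
    rw [h] at h1
    exact neg_of_mul_neg_right h1 hc.le
  · rintro d ⟨W, hW, hneg⟩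
    refine hB.2.2 ⟨W.map e.symm.toLinearMap, by rw [← hW]; exact e.symm.finrank_map_eq W, ?_⟩
    rintro _ ⟨v, hv, rfl⟩ hne
    have h1 := hneg v hv (fun h0 => hne (by simp [h0]))
    have h2 := h' v v
    simp only [LinearEquiv.coe_coe]
    rw [h2]
    exact mul_neg_of_pos_of_neg hc h1

theorem nondegWithIndex_equiv_iff {B : LinearMap.BilinForm ℝ V} {B' : LinearMap.BilinForm ℝ V'}
    (e : V ≃ₗ[ℝ] V') {c : ℝ} (hc : 0 < c) (h : ∀ v w, B v w = c * B' (e v) (e w)) {i : ℕ} :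
    NondegWithIndex B i ↔ NondegWithIndex B' i :=
  ⟨.of_equiv e hc h, .of_equiv e.symm (inv_pos.2 hc) fun v w => by
    simp [h, hc.ne']⟩

/-- Sylvester's law: the orthogonal of a maximal negative definite `W` is a complement of `W` on
which `B` is positive definite, and any positive definite subspace meets `W` only in `0`. -/
theorem NondegWithIndex.neg [FiniteDimensional ℝ V] {B : LinearMap.BilinForm ℝ V}
    (hs : ∀ v w, B v w = B w v) {i : ℕ} (hB : NondegWithIndex B i) :
    NondegWithIndex (-B) (Module.finrank ℝ V - i) := by
  obtain ⟨hnd, ⟨W, hW, hneg⟩, hmax⟩ := hB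
  have hrefl : B.IsRefl := fun v w h => by rw [hs]; exact h
  have hdisj : Disjoint W (B.orthogonal W) := by
    rw [Submodule.disjoint_def]
    intro v hv hv'
    by_contra hne
    have h1 := hneg v hv hne
    have h2 : B v v = 0 := LinearMap.BilinForm.mem_orthogonal_iff.1 hv' v hv
    linarith
  have hcompl : IsCompl W (B.orthogonal W) :=
    (LinearMap.BilinForm.isCompl_orthogonal_iff_disjoint hrefl).2 hdisj
  have hrank := Submodule.finrank_add_eq_of_isCompl hcompl
  -- A vector with `B v v < 0` here would enlarge `W` to a negative definite subspace of dimension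
  -- `i + 1`.
  have hnonneg : ∀ v ∈ B.orthogonal W, 0 ≤ B v v := by
    intro v hv
    by_contra hlt
    push Not at hlt
    have hne : v ≠ 0 := by rintro rfl; simp at hlt
    have hvW : Disjoint W (ℝ ∙ v) :=
      hdisj.mono_right (by simpa [Submodule.span_singleton_le_iff_mem] using hv)
    have hle : Module.finrank ℝ ↥(W ⊔ ℝ ∙ v) ≤ i := by
      refine hmax ⟨_, rfl, ?_⟩
      intro u hu hu0
      obtain ⟨w, hw, x, hx, rfl⟩ := Submodule.mem_sup.1 hu
      obtain ⟨t, rfl⟩ := Submodule.mem_span_singleton.1 hx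
      have hwv : B w v = 0 := LinearMap.BilinForm.mem_orthogonal_iff.1 hv w hw
      have hvw : B v w = 0 := by rw [hs]; exact hwv
      have hexp : B (w + t • v) (w + t • v) = B w w + t ^ 2 * B v v := by
        simp [hwv, hvw]; ring
      rw [hexp]
      by_cases hw0 : w = 0
      · have ht : t ≠ 0 := by rintro rfl; simp [hw0] at hu0
        have : 0 < t ^ 2 := by positivity
        simp only [hw0, map_zero, zero_add]
        nlinarith
      · have h1 := hneg w hw hw0
        nlinarith [sq_nonneg t]
    have h2 := Submodule.finrank_sup_add_finrank_inf_eq W (ℝ ∙ v)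
    rw [hvW.eq_bot, finrank_bot, finrank_span_singleton hne] at h2
    omega
  have hpos : ∀ v ∈ B.orthogonal W, v ≠ 0 → 0 < B v v := by
    intro v hv hne
    refine lt_of_le_of_ne (hnonneg v hv) fun h0 => hne (hnd v fun w => ?_)
    have horth : ∀ x ∈ B.orthogonal W, B v x = 0 := by
      intro x hx
      have hq : ∀ t : ℝ, 0 ≤ t * (2 * B v x) + B x x + t * t * B v v := fun t => by
        have := hnonneg (t • v + x) (add_mem (Submodule.smul_mem _ _ hv) hx)
        simp only [map_add, LinearMap.add_apply, map_smul, LinearMap.smul_apply, smul_eq_mul,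
          hs x v] at this
        linarith
      rw [← h0] at hq
      by_contra hne
      -- With `B v v = 0` the quadratic is affine in `t`; this `t` gives it the value `-1`.
      have := hq (-(B x x + 1) / (2 * B v x))
      rw [div_mul_cancel₀ _ (by simpa using hne)] at this
      linarith
    obtain ⟨a, ha, b, hb, rfl⟩ := Submodule.mem_sup.1 (hcompl.sup_eq_top ▸ Submodule.mem_top (x := w))
    rw [map_add, horth b hb, hs v a, LinearMap.BilinForm.mem_orthogonal_iff.1 hv a ha, add_zero]
  refine ⟨fun v hv => hnd v fun w => by simpa using hv w, ⟨B.orthogonal W, by omega, ?_⟩, ?_⟩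
  · intro v hv hne
    simpa using hpos v hv hne
  · rintro d ⟨U, hU, hUneg⟩
    have hdU : Disjoint W U := by
      rw [Submodule.disjoint_def]
      intro v hv hv'
      by_contra hne
      have h1 := hneg v hv hne
      have h2 := hUneg v hv' hne
      simp only [LinearMap.neg_apply] at h2
      linarith
    have h2 := Submodule.finrank_sup_add_finrank_inf_eq W U
    rw [hdU.eq_bot, finrank_bot] at h2
    have h3 := Submodule.finrank_le (W ⊔ U)
    omega

theorem nondegWithIndex_neg_iff [FiniteDimensional ℝ V] {B : LinearMap.BilinForm ℝ V}
    (hs : ∀ v w, B v w = B w v) {i : ℕ} (hi : i ≤ Module.finrank ℝ V) :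
    NondegWithIndex B i ↔ NondegWithIndex (-B) (Module.finrank ℝ V - i) := by
  refine ⟨.neg hs, fun h => ?_⟩
  have := h.neg (by simp [hs])
  have hBB : - -B = B := by ext; simp
  rwa [hBB, Nat.sub_sub_self hi] at this

end LinearAlgebra

/-! ### Index of forms related by inversion. -/

section InverseForms

variable {V : Type*} [NormedAddCommGroup V] [InnerProductSpace ℝ V]

/-- Cauchy–Schwarz for a semidefinite form, by the discriminant of `t ↦ R (t v + w) (t v + w)`. -/
theorem sq_le_mul_of_nonneg {R : LinearMap.BilinForm ℝ V} (hs : ∀ v w, R v w = R w v)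
    (hR : ∀ v, 0 ≤ R v v) (v w : V) : R v w ^ 2 ≤ R v v * R w w := by
  have h : ∀ t : ℝ, 0 ≤ R v v * (t * t) + 2 * R v w * t + R w w := fun t => by
    have := hR (t • v + w)
    simp only [map_add, LinearMap.add_apply, map_smul, LinearMap.smul_apply, smul_eq_mul,
      hs w v] at this
    linarith
  have := discrim_le_zero h
  simp only [discrim] at this
  nlinarith

/-- If `R = ρ + B` is positive and `A = ρ⁻¹ - ρ⁻² B'` is its inverse, then `B` and `B'` have the
same index. -/
theorem nondegWithIndex_iff_of_inverse {B B' R : LinearMap.BilinForm ℝ V} {A : V →ₗ[ℝ] V} {ρ : ℝ}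
    (hρ : 0 < ρ) (hs : ∀ v w, R v w = R w v) (hR : ∀ v, 0 ≤ R v v)
    (hB : ∀ v w, R v w = ρ * inner ℝ v w + B v w) (hRA : ∀ v w, R (A v) w = inner ℝ v w)
    (hB' : ∀ v w, inner ℝ (A v) w = ρ⁻¹ * inner ℝ v w - ρ⁻¹ ^ 2 * B' v w) {i : ℕ} :
    NondegWithIndex B i ↔ NondegWithIndex B' i := by
  have hBB' : ∀ v w, B' v w = ρ * inner ℝ v w - ρ ^ 2 * inner ℝ (A v) w := fun v w => by
    rw [hB']; field_simp; ring
  have hAinj : Function.Injective A := by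
    rw [← LinearMap.ker_eq_bot, LinearMap.ker_eq_bot']
    intro v hv
    have := hRA v v
    rw [hv] at this
    simpa using this.symm
  have hnd : (∀ v, (∀ w, B v w = 0) → v = 0) ↔ (∀ v, (∀ w, B' v w = 0) → v = 0) := by
    have key : ∀ v, (∀ w, B v w = 0) ↔ (∀ w, B' v w = 0) := by
      intro v
      -- `B' v` is represented by `ρ (v - ρ A v)`, so both kernels are described by `v = ρ A v`.
      have hA : (∀ w, B' v w = 0) ↔ v = ρ • A v := by
        rw [← sub_eq_zero, ← inner_self_eq_zero (𝕜 := ℝ)]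
        constructor
        · intro h
          have := h (v - ρ • A v)
          rw [hBB'] at this
          rw [inner_sub_left, real_inner_smul_left]
          have : ρ * (inner ℝ v (v - ρ • A v) - ρ * inner ℝ (A v) (v - ρ • A v)) = 0 := by
            linarith
          simpa [hρ.ne'] using this
        · intro h w
          rw [inner_self_eq_zero, sub_eq_zero] at h
          have h2 : inner ℝ v w = ρ * inner ℝ (A v) w := by
            conv_lhs => rw [h]
            rw [real_inner_smul_left]
          rw [hBB', h2]; ring
      rw [hA]
      constructor
      · intro h
        have h0 : ∀ w, R (v - ρ • A v) w = 0 := fun w => by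
          rw [map_sub, LinearMap.sub_apply, map_smul, LinearMap.smul_apply, hRA, hB, h]
          simp
        rw [← sub_eq_zero, ← inner_self_eq_zero (𝕜 := ℝ), ← hRA, hs, h0]
      · intro h w
        have h1 := hB v w
        have h2 : R v w = ρ * R (A v) w := by
          conv_lhs => rw [h]
          simp
        rw [hRA] at h2
        linarith
    simp only [key]
  have hto : ∀ W : Submodule ℝ V, (∀ v ∈ W, v ≠ 0 → B v v < 0) → ∀ v ∈ W, v ≠ 0 → B' v v < 0 := by
    intro W hW v hv hne
    have h1 := hW v hv hne
    -- Cauchy–Schwarz reads `‖v‖⁴ ≤ ⟪A v, v⟫ R(v, v)`; with `R(v, v) < ρ ‖v‖²` it yields `‖v‖² < ρ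
    -- ⟪A v, v⟫`, which is `B' v v < 0`.
    have h2 := sq_le_mul_of_nonneg hs hR (A v) v
    have h3 := hB v v
    have hv0 : 0 < inner ℝ v v := real_inner_self_pos.2 hne
    rw [hRA, hRA, real_inner_comm (A v) v] at h2
    rw [hBB']
    have h4 : R v v < ρ * inner ℝ v v := by linarith
    have h5 : 0 < inner ℝ (A v) v := by
      by_contra hle
      push Not at hle
      nlinarith [mul_nonneg (neg_nonneg.2 hle) (hR v), pow_pos hv0 2]
    have h6 : inner ℝ v v ^ 2 < inner ℝ (A v) v * (ρ * inner ℝ v v) :=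
      h2.trans_lt (by gcongr)
    have h7 : inner ℝ v v < ρ * inner ℝ (A v) v := by nlinarith
    nlinarith
  -- Conversely the subspace is moved by `A`: `B(A v, A v) = ⟪v, A v⟫ - ρ ‖A v‖²`, which is negative
  -- by Cauchy–Schwarz for the inner product and `‖v‖² < ρ ⟪A v, v⟫`.
  have hfrom : ∀ W : Submodule ℝ V, (∀ v ∈ W, v ≠ 0 → B' v v < 0) →
      ∀ v ∈ W.map A, v ≠ 0 → B v v < 0 := by
    rintro W hW _ ⟨v, hv, rfl⟩ hne
    have hne' : v ≠ 0 := by rintro rfl; simp at hne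
    have h1 := hW v hv hne'
    rw [hBB'] at h1
    have h3 := hB (A v) (A v)
    rw [hRA] at h3
    have hv0 : 0 < inner ℝ v v := real_inner_self_pos.2 hne'
    have hw0 : 0 < inner ℝ (A v) (A v) := real_inner_self_pos.2 hne
    have h2 := real_inner_mul_inner_self_le (A v) v
    have h4 : inner ℝ v v < ρ * inner ℝ (A v) v := by nlinarith
    have h5 : 0 < inner ℝ (A v) v := by nlinarith
    rw [real_inner_comm (A v) v] at h3
    have h6 : inner ℝ (A v) v < ρ * inner ℝ (A v) (A v) := by nlinarith
    linarith
  have hset : ∀ d, (∃ W : Submodule ℝ V, Module.finrank ℝ W = d ∧ ∀ v ∈ W, v ≠ 0 → B v v < 0) ↔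
      (∃ W : Submodule ℝ V, Module.finrank ℝ W = d ∧ ∀ v ∈ W, v ≠ 0 → B' v v < 0) := by
    refine fun d => ⟨fun ⟨W, hd, hW⟩ => ⟨W, hd, hto W hW⟩, fun ⟨W, hd, hW⟩ => ⟨W.map A, ?_, hfrom W hW⟩⟩
    rw [← hd]
    exact (Submodule.equivMapOfInjective A hAinj W).finrank_eq.symm
  unfold NondegWithIndex
  rw [hnd]
  simp only [hset]

end InverseForms

/-! ### Second derivatives of compositions and products, and the second-order condition. -/

section SecondDerivative

variable {X Y : Type*} [NormedAddCommGroup X] [NormedSpace ℝ X]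
  [NormedAddCommGroup Y] [NormedSpace ℝ Y]

theorem ContDiffAt.eventually_differentiableAt {f : X → Y} {x : X} (hf : ContDiffAt ℝ 2 f x) :
    ∀ᶠ y in 𝓝 x, DifferentiableAt ℝ f y :=
  (hf.eventually (by simp)).mono fun _ h => h.differentiableAt (by simp)

theorem ContDiffAt.differentiableAt_fderiv {f : X → Y} {x : X} (hf : ContDiffAt ℝ 2 f x) :
    DifferentiableAt ℝ (fderiv ℝ f) x :=
  (hf.fderiv_right (m := 1) (by norm_num)).differentiableAt (by simp)

/-- At a critical point of `G` the last term vanishes, so the Hessian transforms as a bilinear form.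
-/
theorem fderiv_fderiv_comp {G : Y → ℝ} {f : X → Y} {x : X} (hG : ContDiffAt ℝ 2 G (f x))
    (hf : ContDiffAt ℝ 2 f x) (v w : X) :
    fderiv ℝ (fderiv ℝ (G ∘ f)) x v w =
      fderiv ℝ (fderiv ℝ G) (f x) (fderiv ℝ f x v) (fderiv ℝ f x w) +
        fderiv ℝ G (f x) (fderiv ℝ (fderiv ℝ f) x v w) := by
  have h1 : fderiv ℝ (G ∘ f) =ᶠ[𝓝 x] fun y => (fderiv ℝ G (f y)).comp (fderiv ℝ f y) := by
    filter_upwards [hf.eventually_differentiableAt,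
      hf.continuousAt.eventually hG.eventually_differentiableAt] with y h2 h3
    exact fderiv_comp y h3 h2
  have h4 := (hG.differentiableAt_fderiv.hasFDerivAt.comp x
    (hf.differentiableAt (by simp)).hasFDerivAt).clm_comp hf.differentiableAt_fderiv.hasFDerivAt
  rw [h1.fderiv_eq]
  refine (congrArg (fun L => L v w) h4.fderiv).trans ?_
  simp [add_comm]

theorem fderiv_fderiv_mul {p q : X → ℝ} {x : X} (hp : ContDiffAt ℝ 2 p x)
    (hq : ContDiffAt ℝ 2 q x) (v w : X) :
    fderiv ℝ (fderiv ℝ fun y => p y * q y) x v w =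
      p x * fderiv ℝ (fderiv ℝ q) x v w + fderiv ℝ p x v * fderiv ℝ q x w +
        (q x * fderiv ℝ (fderiv ℝ p) x v w + fderiv ℝ q x v * fderiv ℝ p x w) := by
  have h1 : (fderiv ℝ fun y => p y * q y) =ᶠ[𝓝 x]
      fun y => p y • fderiv ℝ q y + q y • fderiv ℝ p y := by
    filter_upwards [hp.eventually_differentiableAt, hq.eventually_differentiableAt] with y h2 h3
    exact fderiv_fun_mul h2 h3
  have h4 := ((hp.differentiableAt (by simp)).hasFDerivAt.smul
    hq.differentiableAt_fderiv.hasFDerivAt).add ((hq.differentiableAt (by simp)).hasFDerivAt.smul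
    hp.differentiableAt_fderiv.hasFDerivAt)
  have h5 := h4.fderiv
  rw [h1.fderiv_eq]
  refine (congrArg (fun L => L v w) h5).trans ?_
  simp

/-- The necessary second order condition at a local minimum. -/
theorem IsLocalMin.fderiv_fderiv_nonneg {f : X → ℝ} {x : X} (h : IsLocalMin f x)
    (hf : ContDiffAt ℝ 2 f x) (v : X) : 0 ≤ fderiv ℝ (fderiv ℝ f) x v v := by
  by_contra hlt
  push Not at hlt
  let l : ℝ → X := fun t => x + t • v
  have hl : ∀ t, HasDerivAt l v t := fun t => by
    have h1 := ((hasDerivAt_id t).smul_const v).const_add x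
    rw [one_smul] at h1
    exact h1
  have hl0 : l 0 = x := by simp [l]
  have hlc : ContinuousAt l 0 := (hl 0).continuousAt
  have hfl : ContDiffAt ℝ 2 f (l 0) := by rwa [hl0]
  have hd : deriv (f ∘ l) =ᶠ[𝓝 0] fun t => fderiv ℝ f (l t) v := by
    filter_upwards [hlc.eventually hfl.eventually_differentiableAt] with t ht
    exact (ht.hasFDerivAt.comp_hasDerivAt t (hl t)).deriv
  have hd0 : deriv (f ∘ l) 0 = 0 := by
    rw [hd.eq_of_nhds, hl0, h.fderiv_eq_zero]; rfl
  have hdd : deriv (deriv (f ∘ l)) 0 = fderiv ℝ (fderiv ℝ f) x v v := by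
    rw [hd.deriv_eq]
    have h1 := (hfl.differentiableAt_fderiv.hasFDerivAt.comp_hasDerivAt 0 (hl 0))
    have h2 := h1.clm_apply (hasDerivAt_const (0 : ℝ) v)
    rw [hl0] at h2
    simpa using h2.deriv
  have hcont : ContinuousAt (f ∘ l) 0 := hfl.continuousAt.comp hlc
  -- Along the line the point is both a local maximum and a local minimum, so the function is
  -- locally constant there and its second derivative is zero.
  have hmax := isLocalMax_of_deriv_deriv_neg (hdd ▸ hlt) hd0 hcont
  have hmin : IsLocalMin (f ∘ l) 0 := by
    have : Filter.Tendsto l (𝓝 0) (𝓝 x) := by rw [← hl0]; exact hlc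
    filter_upwards [this.eventually h] with t ht
    simpa [hl0] using ht
  have hconst : f ∘ l =ᶠ[𝓝 0] fun _ => f x := by
    filter_upwards [hmax, hmin] with t h1 h2
    have := le_antisymm h1 h2
    simpa [hl0] using this
  have h3 : deriv (f ∘ l) =ᶠ[𝓝 0] fun _ => 0 := by
    simpa using hconst.deriv
  have := h3.deriv_eq
  rw [hdd] at this
  simp at this
  linarith

end SecondDerivative

/-! ### Derivatives of the norm at a unit vector. -/

section Norm

variable {E : Type*} [NormedAddCommGroup E] [InnerProductSpace ℝ E]

theorem hasFDerivAt_norm_of_ne_zero {x : E} (hx : x ≠ 0) :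
    HasFDerivAt (fun y : E => ‖y‖) (‖x‖⁻¹ • innerSL ℝ x) x := by
  have h1 : HasFDerivAt (fun y : E => Real.sqrt (‖y‖ ^ 2)) _ x :=
    (hasStrictFDerivAt_norm_sq x).hasFDerivAt.sqrt (by positivity)
  simp only [Real.sqrt_sq (norm_nonneg _)] at h1
  convert h1 using 1
  ext v
  simp
  field_simp

theorem fderiv_fderiv_norm {x : E} (hx : ‖x‖ = 1) {v : E} (hv : inner ℝ x v = 0) (w : E) :
    fderiv ℝ (fderiv ℝ fun y : E => ‖y‖) x v w = inner ℝ v w := by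
  have hx0 : x ≠ 0 := by rintro rfl; simp at hx
  have h1 : (fderiv ℝ fun y : E => ‖y‖) =ᶠ[𝓝 x] fun y => ‖y‖⁻¹ • innerSL ℝ y := by
    filter_upwards [isOpen_ne.mem_nhds hx0] with y hy
    exact (hasFDerivAt_norm_of_ne_zero hy).fderiv
  have h2 : HasFDerivAt (fun y : E => ‖y‖⁻¹) _ x :=
    (hasDerivAt_inv (norm_ne_zero_iff.2 hx0)).comp_hasFDerivAt x (hasFDerivAt_norm_of_ne_zero hx0)
  have h3 := h2.smul (innerSL ℝ (E := E)).hasFDerivAt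
  rw [h1.fderiv_eq]
  refine (congrArg (fun L => L v w) h3.fderiv).trans ?_
  simp only [hx, hv, inv_one, one_smul, one_pow, ContinuousLinearMap.smulRight_apply,
    add_apply, smul_apply, innerSL_apply_apply, smul_zero, zero_smul, add_zero]
  rfl

end Norm

/-! ### Mutually polar gauges and their gradients. -/

section DualPair

variable {E : Type*} [NormedAddCommGroup E] [InnerProductSpace ℝ E]

/-- A pair of mutually polar smooth gauges on an inner product space. -/
structure DualPair (h j : E → ℝ) : Prop where
  pos_left : ∀ x, x ≠ 0 → 0 < h x
  pos_right : ∀ x, x ≠ 0 → 0 < j x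
  smul_left : ∀ (t : ℝ) (x), 0 < t → h (t • x) = t * h x
  smul_right : ∀ (t : ℝ) (x), 0 < t → j (t • x) = t * j x
  contDiffAt_left : ∀ x, x ≠ 0 → ContDiffAt ℝ 2 h x
  contDiffAt_right : ∀ x, x ≠ 0 → ContDiffAt ℝ 2 j x
  inner_le : ∀ x u, inner ℝ x u ≤ j x * h u
  exists_left : ∀ x, x ≠ 0 → ∃ u, u ≠ 0 ∧ inner ℝ x u = j x * h u
  exists_right : ∀ u, u ≠ 0 → ∃ x, x ≠ 0 ∧ inner ℝ x u = j x * h u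

variable (E) in
/-- The inverse of the Riesz isomorphism, as a real-linear map. -/
def rieszInv [CompleteSpace E] : StrongDual ℝ E →L[ℝ] E where
  toFun := (InnerProductSpace.toDual ℝ E).symm
  map_add' := by simp
  map_smul' := by simp
  cont := (InnerProductSpace.toDual ℝ E).symm.continuous

@[simp]
theorem inner_rieszInv [CompleteSpace E] (f : StrongDual ℝ E) (y : E) :
    inner ℝ (rieszInv E f) y = f y :=
  InnerProductSpace.toDual_symm_apply

namespace DualPair

variable {h j : E → ℝ}

theorem symm (H : DualPair h j) : DualPair j h where
  pos_left := H.pos_right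
  pos_right := H.pos_left
  smul_left := H.smul_right
  smul_right := H.smul_left
  contDiffAt_left := H.contDiffAt_right
  contDiffAt_right := H.contDiffAt_left
  inner_le x u := by rw [real_inner_comm, mul_comm]; exact H.inner_le u x
  exists_left x hx := by
    obtain ⟨u, hu, hux⟩ := H.exists_right x hx
    exact ⟨u, hu, by rw [real_inner_comm, mul_comm]; exact hux⟩
  exists_right x hx := by
    obtain ⟨u, hu, hux⟩ := H.exists_left x hx
    exact ⟨u, hu, by rw [real_inner_comm, mul_comm]; exact hux⟩

/-- The function is nonnegative everywhere and zero at `u`. Its first- and second-order conditions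
give the gradient of `h` and the semidefiniteness of its Hessian. -/
theorem isLocalMin (H : DualPair h j) {x u : E} (hxu : inner ℝ x u = j x * h u) :
    IsLocalMin (fun y => j x * h y - inner ℝ x y) u :=
  Filter.Eventually.of_forall fun y => by
    have := H.inner_le x y
    simp only [hxu, sub_self]
    linarith

theorem smul_fderiv_eq (H : DualPair h j) {x u : E} (hu : u ≠ 0)
    (hxu : inner ℝ x u = j x * h u) : j x • fderiv ℝ h u = innerSL ℝ x := by
  have h1 : HasFDerivAt (fun y => j x * h y - innerSL ℝ x y)
      (j x • fderiv ℝ h u - innerSL ℝ x) u :=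
    ((((H.contDiffAt_left u hu).differentiableAt (by simp)).hasFDerivAt).const_mul (j x)).sub
      (innerSL ℝ x).hasFDerivAt
  exact sub_eq_zero.1 ((H.isLocalMin hxu).hasFDerivAt_eq_zero h1)

theorem fderiv_fderiv_nonneg (H : DualPair h j) {x u : E} (hx : x ≠ 0) (hu : u ≠ 0)
    (hxu : inner ℝ x u = j x * h u) (v : E) : 0 ≤ fderiv ℝ (fderiv ℝ h) u v v := by
  have hh := H.contDiffAt_left u hu
  have hc : ContDiffAt ℝ 2 (fun y => j x * h y - innerSL ℝ x y) u :=
    (contDiffAt_const.mul hh).sub (innerSL ℝ x).contDiff.contDiffAt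
  have h1 := (H.isLocalMin hxu).fderiv_fderiv_nonneg hc v
  have h2 : (fderiv ℝ fun y => j x * h y - inner ℝ x y) =ᶠ[𝓝 u]
      fun y => j x • fderiv ℝ h y - innerSL ℝ x := by
    filter_upwards [hh.eventually_differentiableAt] with y hy
    exact ((hy.hasFDerivAt.const_mul (j x)).sub (innerSL ℝ x).hasFDerivAt).fderiv
  have h3 : HasFDerivAt (fun y => j x • fderiv ℝ h y - innerSL ℝ x) _ u :=
    (hh.differentiableAt_fderiv.hasFDerivAt.const_smul (j x)).sub_const (innerSL ℝ x)
  rw [h2.fderiv_eq, h3.fderiv] at h1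
  simp only [smul_apply, smul_eq_mul] at h1
  exact nonneg_of_mul_nonneg_right h1 (H.pos_right x hx)

/-- The partner `x` of `θ` is `j(x) ∇h(θ) = j(x) h(θ) θ`. Homogeneity gives `j(x) = j(x) h(θ) j(θ)`,
and `j(x)` cancels. -/
theorem mul_eq_one_of_fderiv_eq (H : DualPair h j) {θ : E} (hθ : ‖θ‖ = 1)
    (hc : fderiv ℝ h θ = h θ • innerSL ℝ θ) : j θ * h θ = 1 := by
  have hθ0 : θ ≠ 0 := by rintro rfl; simp at hθ
  obtain ⟨x, hx, hxθ⟩ := H.exists_right θ hθ0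
  have h1 := H.smul_fderiv_eq hθ0 hxθ
  have hpos : 0 < j x * h θ := mul_pos (H.pos_right x hx) (H.pos_left θ hθ0)
  have h2 : x = (j x * h θ) • θ := by
    refine ext_inner_right ℝ fun y => ?_
    have := congrArg (fun L => L y) h1
    simp only [hc, smul_apply, innerSL_apply_apply, smul_eq_mul] at this
    rw [real_inner_smul_left, ← this]; ring
  have h3 : j x = j x * h θ * j θ := by
    conv_lhs => rw [h2]
    exact H.smul_right _ _ hpos
  have h4 := (H.pos_right x hx).ne'
  have : j x * (j θ * h θ - 1) = 0 := by linarith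
  rcases mul_eq_zero.1 this with h5 | h5
  · exact absurd h5 h4
  · linarith

/-- Since `j(θ) h(θ) = 1 = ⟪θ, θ⟫`, the vector `θ` is its own partner, so the first-order condition
for `j` applies at `θ`. -/
theorem fderiv_right_of_fderiv_left (H : DualPair h j) {θ : E} (hθ : ‖θ‖ = 1)
    (hc : fderiv ℝ h θ = h θ • innerSL ℝ θ) : fderiv ℝ j θ = j θ • innerSL ℝ θ := by
  have hθ0 : θ ≠ 0 := by rintro rfl; simp at hθ
  have h1 := H.mul_eq_one_of_fderiv_eq hθ hc
  have h2 := H.symm.smul_fderiv_eq (x := θ) (u := θ) hθ0 (by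
    rw [real_inner_self_eq_norm_sq, hθ, mul_comm, h1]; norm_num)
  rw [← h2, smul_smul, h1, one_smul]

/-- Differentiate Euler's relation `j'(x) x = j(x)`, itself read off from the first-order condition
at a partner of `x`. -/
theorem fderiv_fderiv_self_right (H : DualPair h j) {θ : E} (hθ : θ ≠ 0) (v : E) :
    fderiv ℝ (fderiv ℝ j) θ v θ = 0 := by
  have h1 : (fun x => fderiv ℝ j x x) =ᶠ[𝓝 θ] j := by
    filter_upwards [isOpen_ne.mem_nhds hθ] with x hx
    obtain ⟨u, hu, hxu⟩ := H.exists_left x hx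
    have h2 := H.symm.smul_fderiv_eq (x := u) hx (by rw [real_inner_comm, mul_comm]; exact hxu)
    have h3 := congrArg (fun L => L x) h2
    simp only [smul_apply, innerSL_apply_apply, smul_eq_mul] at h3
    rw [real_inner_comm, hxu, mul_comm] at h3
    exact mul_right_cancel₀ (H.pos_left u hu).ne' h3
  have hj := H.contDiffAt_right θ hθ
  have h4 := hj.differentiableAt_fderiv.hasFDerivAt.clm_apply (hasFDerivAt_id θ)
  have h5 := h4.unique (h1.hasFDerivAt_iff.2 (hj.differentiableAt (by simp)).hasFDerivAt)
  simpa using congrArg (fun L => L v) h5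

variable [CompleteSpace E]

/-- The gradient of `j` at `x` is a positive multiple of a partner of `x`, and positive multiples of
partners are partners. The free factor `c` lets the base point be normalised later. -/
theorem smul_fderiv_smul_gradient (H : DualPair h j) {x : E} (hx : x ≠ 0) {c : ℝ} (hc : 0 < c) :
    j x • fderiv ℝ h (c • gradient j x) = innerSL ℝ x := by
  obtain ⟨u, hu, hxu⟩ := H.exists_left x hx
  have h1 := H.symm.smul_fderiv_eq (x := u) hx (by rw [real_inner_comm, mul_comm]; exact hxu)
  have hpos := H.pos_left u hu
  have h2 : gradient j x = (h u)⁻¹ • u := by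
    refine ext_inner_right ℝ fun y => ?_
    have := congrArg (fun L => L y) h1
    simp only [smul_apply, innerSL_apply_apply, smul_eq_mul] at this
    rw [real_inner_smul_left, ← this]
    simp [gradient, hpos.ne']
  have ht : 0 < c * (h u)⁻¹ := by positivity
  rw [h2, smul_smul]
  refine H.smul_fderiv_eq (smul_ne_zero ht.ne' hu) ?_
  rw [real_inner_smul_right, H.smul_left _ _ ht, hxu]
  ring

theorem hasFDerivAt_gradient (H : DualPair h j) {θ : E} (hθ : θ ≠ 0) :
    HasFDerivAt (gradient j)
      ((rieszInv E).comp (fderiv ℝ (fderiv ℝ j) θ)) θ := by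
  have h1 := (H.contDiffAt_right θ hθ).differentiableAt_fderiv.hasFDerivAt
  exact (rieszInv E).hasFDerivAt.comp θ h1

/-- The derivatives of the gradients of two mutually polar gauges are inverse to each other. -/
theorem fderiv_fderiv_gradient (H : DualPair h j) {θ : E} (hθ : ‖θ‖ = 1)
    (hc : fderiv ℝ j θ = j θ • innerSL ℝ θ) {v : E} (hv : inner ℝ θ v = 0) (w : E) :
    fderiv ℝ (fderiv ℝ h) θ (rieszInv E (fderiv ℝ (fderiv ℝ j) θ v)) w = inner ℝ v w := by
  have hθ0 : θ ≠ 0 := by rintro rfl; simp at hθ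
  have hj := H.pos_right θ hθ0
  -- At a critical direction, the choice `c = (j θ)⁻¹` makes `θ` the base point for `h` too.
  have hg : (j θ)⁻¹ • gradient j θ = θ := by
    refine ext_inner_right ℝ fun y => ?_
    have h0 : inner ℝ (gradient j θ) y = fderiv ℝ j θ y := inner_rieszInv _ y
    rw [real_inner_smul_left, h0, hc]
    simp [hj.ne']
  have h1 : (fun x => j x • fderiv ℝ h ((j θ)⁻¹ • gradient j x)) =ᶠ[𝓝 θ] fun x => innerSL ℝ x := by
    filter_upwards [isOpen_ne.mem_nhds hθ0] with x hx
    exact H.smul_fderiv_smul_gradient hx (inv_pos.2 hj)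
  have h2 := (H.hasFDerivAt_gradient hθ0).const_smul (j θ)⁻¹
  have h3 : HasFDerivAt (fderiv ℝ h) (fderiv ℝ (fderiv ℝ h) θ) ((j θ)⁻¹ • gradient j θ) := by
    rw [hg]; exact (H.contDiffAt_left θ hθ0).differentiableAt_fderiv.hasFDerivAt
  -- In the product rule the term with `j'(θ) v` vanishes because `v ⟂ θ`, and the remaining factor
  -- `j θ` cancels `(j θ)⁻¹`.
  have h4 := (((H.contDiffAt_right θ hθ0).differentiableAt (by simp)).hasFDerivAt).smul
    (h3.comp θ h2)
  have h5 := h4.unique (h1.hasFDerivAt_iff.2 (innerSL ℝ (E := E)).hasFDerivAt)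
  have h6 := congrArg (fun L => L v w) h5
  simp [hc, hv, hj.ne'] at h6
  exact h6

end DualPair

/-! ### Hessians on `θᗮ`: comparing a function with its gauge and with its inverse. -/

/-- The restriction of the second derivative of `F` at `θ` to the orthogonal complement of `θ`. -/
def tangentHessian (F : E → ℝ) (θ : E) : LinearMap.BilinForm ℝ (ℝ ∙ θ)ᗮ :=
  LinearMap.mk₂ ℝ (fun v w => fderiv ℝ (fderiv ℝ F) θ v w)
    (by simp) (by simp) (by simp) (by simp)

@[simp]
theorem tangentHessian_apply (F : E → ℝ) (θ : E) (v w : (ℝ ∙ θ)ᗮ) :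
    tangentHessian F θ v w = fderiv ℝ (fderiv ℝ F) θ v w := rfl

theorem tangentHessian_symm {F : E → ℝ} {θ : E} (hF : ContDiffAt ℝ 2 F θ) (v w : (ℝ ∙ θ)ᗮ) :
    tangentHessian F θ v w = tangentHessian F θ w v :=
  hF.isSymmSndFDerivAt (by simp) v w

theorem fderiv_norm_mul {F : E → ℝ} {θ : E} (hθ : ‖θ‖ = 1) (hF : ContDiffAt ℝ 2 F θ) :
    fderiv ℝ (fun x => ‖x‖ * F x) θ = F θ • innerSL ℝ θ + fderiv ℝ F θ := by
  have hθ0 : θ ≠ 0 := by rintro rfl; simp at hθ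
  have := ((hasFDerivAt_norm_of_ne_zero hθ0).mul (hF.differentiableAt (by simp)).hasFDerivAt).fderiv
  refine this.trans ?_
  simp [hθ, add_comm]

theorem fderiv_norm_mul_eq_iff {F : E → ℝ} {θ : E} (hθ : ‖θ‖ = 1) (hF : ContDiffAt ℝ 2 F θ) :
    fderiv ℝ (fun x => ‖x‖ * F x) θ = (‖θ‖ * F θ) • innerSL ℝ θ ↔ fderiv ℝ F θ = 0 := by
  rw [fderiv_norm_mul hθ hF, hθ, one_mul]
  simp

/-- The cross terms carry `F'(θ) = 0`, and the Hessian of the norm is the inner product in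
tangential directions. -/
theorem fderiv_fderiv_norm_mul {F : E → ℝ} {θ : E} (hθ : ‖θ‖ = 1) (hF : ContDiffAt ℝ 2 F θ)
    (hc : fderiv ℝ F θ = 0) {v : E} (hv : inner ℝ θ v = 0) (w : E) :
    fderiv ℝ (fderiv ℝ fun x => ‖x‖ * F x) θ v w =
      F θ * inner ℝ v w + fderiv ℝ (fderiv ℝ F) θ v w := by
  have hθ0 : θ ≠ 0 := by rintro rfl; simp at hθ
  rw [fderiv_fderiv_mul (contDiffAt_norm ℝ hθ0) hF, fderiv_fderiv_norm hθ hv, hc]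
  simp [hθ, add_comm]

theorem fderiv_inv_eq_zero_iff {F : E → ℝ} {θ : E} (hF : ContDiffAt ℝ 2 F θ) (h0 : F θ ≠ 0) :
    fderiv ℝ (fun x => (F x)⁻¹) θ = 0 ↔ fderiv ℝ F θ = 0 := by
  have h1 := ((hasDerivAt_inv h0).comp_hasFDerivAt θ
    (hF.differentiableAt (by simp)).hasFDerivAt).fderiv
  refine (Eq.congr_left h1).trans ?_
  simp [h0]

theorem fderiv_fderiv_inv {F : E → ℝ} {θ : E} (hF : ContDiffAt ℝ 2 F θ) (h0 : F θ ≠ 0)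
    (hc : fderiv ℝ F θ = 0) (v w : E) :
    fderiv ℝ (fderiv ℝ fun x => (F x)⁻¹) θ v w =
      -(F θ)⁻¹ ^ 2 * fderiv ℝ (fderiv ℝ F) θ v w := by
  have h1 := fderiv_fderiv_comp (G := fun t : ℝ => t⁻¹) (contDiffAt_inv ℝ h0) hF v w
  refine h1.trans ?_
  rw [hc]
  simp [fderiv_eq_smul_deriv]
  ring

/-- Let `F` and `P` be such that `‖x‖ F(x)` and `‖x‖ / P(x)` are mutually polar gauges. Then `F` and
`P` have the same critical points on the sphere, with the same indices. -/
theorem DualPair.crit_nondegWithIndex_iff [CompleteSpace E] {F P : E → ℝ}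
    (H : DualPair (fun x => ‖x‖ * F x) (fun x => ‖x‖ * (P x)⁻¹)) {θ : E} (hθ : ‖θ‖ = 1)
    (hF : ContDiffAt ℝ 2 F θ) (hP : ContDiffAt ℝ 2 P θ) {i : ℕ} :
    (fderiv ℝ F θ = 0 ∧ NondegWithIndex (tangentHessian F θ) i) ↔
      (fderiv ℝ P θ = 0 ∧ NondegWithIndex (tangentHessian P θ) i) := by
  have hθ0 : θ ≠ 0 := by rintro rfl; simp at hθ
  have hP0 : 0 < P θ := by simpa [hθ] using H.pos_right θ hθ0
  have hPi : ContDiffAt ℝ 2 (fun x => (P x)⁻¹) θ := hP.inv hP0.ne'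
  have hcrit : fderiv ℝ F θ = 0 ↔ fderiv ℝ P θ = 0 := by
    rw [← fderiv_norm_mul_eq_iff hθ hF, ← fderiv_inv_eq_zero_iff hP hP0.ne',
      ← fderiv_norm_mul_eq_iff hθ hPi]
    exact ⟨H.fderiv_right_of_fderiv_left hθ, H.symm.fderiv_right_of_fderiv_left hθ⟩
  rw [← hcrit]
  refine and_congr_right fun hc => ?_
  have hcP := hcrit.1 hc
  have hch := (fderiv_norm_mul_eq_iff hθ hF).2 hc
  have hcj := (fderiv_norm_mul_eq_iff hθ hPi).2 ((fderiv_inv_eq_zero_iff hP hP0.ne').2 hcP)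
  have hFP := H.mul_eq_one_of_fderiv_eq hθ hch
  have hFP' : F θ = P θ := by
    simp only [hθ, one_mul] at hFP
    field_simp at hFP
    exact hFP
  have hmem : ∀ v : (ℝ ∙ θ)ᗮ, inner ℝ θ (v : E) = 0 := fun v =>
    Submodule.mem_orthogonal_singleton_iff_inner_right.1 v.2
  -- `A` is the Hessian of `‖x‖ / P` as an operator; it takes values in `θᗮ` by the differentiated
  -- Euler relation.
  let A : (ℝ ∙ θ)ᗮ →ₗ[ℝ] (ℝ ∙ θ)ᗮ :=
    LinearMap.codRestrict _
      (((rieszInv E).comp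
        (fderiv ℝ (fderiv ℝ fun x => ‖x‖ * (P x)⁻¹) θ)).toLinearMap.comp (ℝ ∙ θ)ᗮ.subtype)
      fun v => by
        rw [Submodule.mem_orthogonal_singleton_iff_inner_left]
        have := H.fderiv_fderiv_self_right hθ0 v
        simpa using this
  have hA : ∀ v, (A v : E) = rieszInv E (fderiv ℝ (fderiv ℝ fun x => ‖x‖ * (P x)⁻¹) θ v) :=
    fun v => rfl
  refine nondegWithIndex_iff_of_inverse (R := tangentHessian (fun x => ‖x‖ * F x) θ) (A := A) hP0
    (tangentHessian_symm (H.contDiffAt_left θ hθ0)) (fun v => ?_) (fun v w => ?_) (fun v w => ?_)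
    (fun v w => ?_)
  · refine H.fderiv_fderiv_nonneg hθ0 hθ0 ?_ v
    rw [hFP, real_inner_self_eq_norm_sq, hθ]; norm_num
  · rw [tangentHessian_apply, fderiv_fderiv_norm_mul hθ hF hc (hmem v), hFP']
    rfl
  · rw [tangentHessian_apply, hA, H.fderiv_fderiv_gradient hθ hcj (hmem v)]
    rfl
  · rw [Submodule.coe_inner, hA, inner_rieszInv,
      fderiv_fderiv_norm_mul hθ hPi ((fderiv_inv_eq_zero_iff hP hP0.ne').2 hcP) (hmem v),
      fderiv_fderiv_inv hP hP0.ne' hcP]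
    simp
    ring

end DualPair

/-! ### From charts of the sphere to radially constant extensions. -/

section Sphere

variable {n : ℕ}

/-- The extension of a function on the sphere that is constant on open rays from the origin. -/
def radialExt (f : Sph n → ℝ) (x : Euc n) : ℝ :=
  Function.extend Subtype.val f 0 (‖x‖⁻¹ • x)

theorem radialExt_smul (f : Sph n → ℝ) (θ : Sph n) {r : ℝ} (hr : 0 < r) :
    radialExt f (r • (θ : Euc n)) = f θ := by
  have : ‖r • (θ : Euc n)‖⁻¹ • r • (θ : Euc n) = θ := by
    rw [norm_smul, norm_eq_of_mem_sphere, smul_smul, Real.norm_of_nonneg hr.le, mul_one,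
      inv_mul_cancel₀ hr.ne', one_smul]
  rw [radialExt, this, Subtype.val_injective.extend_apply]

@[simp]
theorem radialExt_coe (f : Sph n → ℝ) (θ : Sph n) : radialExt f (θ : Euc n) = f θ := by
  simpa using radialExt_smul f θ one_pos

theorem radialExt_smul_eq (f : Sph n → ℝ) (x : Euc n) {r : ℝ} (hr : 0 < r) :
    radialExt f (r • x) = radialExt f x := by
  have : ‖r • x‖⁻¹ • r • x = ‖x‖⁻¹ • x := by
    rw [norm_smul, smul_smul, Real.norm_of_nonneg hr.le]
    congr 1
    field_simp
  rw [radialExt, this, radialExt]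

theorem exists_eq_norm_smul {x : Euc n} (hx : x ≠ 0) : ∃ θ : Sph n, x = ‖x‖ • (θ : Euc n) := by
  refine ⟨⟨‖x‖⁻¹ • x, by simp [norm_smul, hx]⟩, ?_⟩
  simp [smul_smul, hx]

theorem exists_eq_pos_smul {x : Euc n} (hx : x ≠ 0) :
    ∃ (θ : Sph n) (r : ℝ), 0 < r ∧ x = r • (θ : Euc n) :=
  let ⟨θ, hθ⟩ := exists_eq_norm_smul hx
  ⟨θ, ‖x‖, norm_pos_iff.2 hx, hθ⟩

/-- The isometry between the orthogonal complement of `-θ` and the model space that is used in the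
preferred chart at `θ`. -/
def tangentIsometry (θ : Sph n) :
    (ℝ ∙ ((-θ : Sph n) : Euc n))ᗮ ≃ₗᵢ[ℝ] EuclideanSpace ℝ (Fin n) :=
  (OrthonormalBasis.fromOrthogonalSpanSingleton n (ne_zero_of_mem_unit_sphere (-θ))).repr

/-- The preferred chart at `θ` is stereographic projection from the antipode, whence `-θ`
throughout; it sends `θ` to `0`. -/
theorem chartAt_apply (θ η : Sph n) : chartAt (EuclideanSpace ℝ (Fin n)) θ η =
    tangentIsometry θ (stereoToFun ((-θ : Sph n) : Euc n) η) := rfl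

@[simp]
theorem chartAt_self (θ : Sph n) : chartAt (EuclideanSpace ℝ (Fin n)) θ θ = 0 := by
  have h1 : stereoToFun ((-θ : Sph n) : Euc n) θ = 0 := stereographic_neg_apply θ
  rw [chartAt_apply, h1, map_zero]

/-- The inverse of the preferred chart at `θ`, with values in the ambient space. -/
def sphereParam (θ : Sph n) (x : EuclideanSpace ℝ (Fin n)) : Euc n :=
  ((chartAt (EuclideanSpace ℝ (Fin n)) θ).symm x : Euc n)

theorem sphereParam_zero (θ : Sph n) : sphereParam θ 0 = θ := by
  rw [sphereParam, ← chartAt_self θ, OpenPartialHomeomorph.left_inv _ (mem_chart_source _ θ)]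

theorem contDiff_sphereParam (θ : Sph n) : ContDiff ℝ 2 (sphereParam θ) :=
  (contDiff_stereoInvFunAux.comp (ℝ ∙ ((-θ : Sph n) : Euc n))ᗮ.subtypeL.contDiff).comp
    (tangentIsometry θ).symm.contDiff

theorem hasFDerivAt_sphereParam (θ : Sph n) :
    HasFDerivAt (sphereParam θ) ((ℝ ∙ ((-θ : Sph n) : Euc n))ᗮ.subtypeL.comp
      ((tangentIsometry θ).symm.toContinuousLinearEquiv :
        EuclideanSpace ℝ (Fin n) →L[ℝ] (ℝ ∙ ((-θ : Sph n) : Euc n))ᗮ)) 0 := by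
  have h1 := hasFDerivAt_stereoInvFunAux_comp_coe ((-θ : Sph n) : Euc n)
  have h2 : (tangentIsometry θ).symm 0 = 0 := map_zero _
  rw [← h2] at h1
  exact h1.comp 0 ((tangentIsometry θ).symm.toContinuousLinearEquiv :
        EuclideanSpace ℝ (Fin n) →L[ℝ] (ℝ ∙ ((-θ : Sph n) : Euc n))ᗮ).hasFDerivAt

theorem comp_chartAt_symm (f : Sph n → ℝ) (θ : Sph n) :
    f ∘ (chartAt (EuclideanSpace ℝ (Fin n)) θ).symm = radialExt f ∘ sphereParam θ := by
  ext x
  exact (radialExt_coe f _).symm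

theorem contDiffAt_comp_chartAt_symm {f : Sph n → ℝ} {θ : Sph n}
    (hf : ContMDiffAt (𝓡 n) 𝓘(ℝ, ℝ) ∞ f θ) :
    ContDiffAt ℝ ∞ (f ∘ (chartAt (EuclideanSpace ℝ (Fin n)) θ).symm) 0 := by
  have h := (contMDiffAt_iff.1 hf).2
  simpa [Function.comp_def, chartAt_self_eq, contDiffWithinAt_univ] using h

/-- Near `x` the extension is radial projection to the sphere, then the chart at `x/‖x‖`, then `f`
read in that chart. -/
theorem contDiffAt_radialExt {f : Sph n → ℝ} (hf : SmoothOnSph f) {x : Euc n} (hx : x ≠ 0) :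
    ContDiffAt ℝ 2 (radialExt f) x := by
  obtain ⟨θ, hθ⟩ := exists_eq_norm_smul hx
  have hn : ‖x‖ ≠ 0 := norm_ne_zero_iff.2 hx
  have hunit : ‖x‖⁻¹ • x = (θ : Euc n) := by
    conv_lhs => rw [hθ]
    simp [norm_smul, smul_smul, hn]
  have h1 : ContDiffAt ℝ 2 (fun y : Euc n => ‖y‖⁻¹ • y) x :=
    ((contDiffAt_norm ℝ hx).inv hn).smul contDiffAt_id
  -- Stereographic projection from `-θ` is smooth off the hyperplane `⟪-θ, y⟫ = 1`, which `θ`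
  -- avoids.
  have hsub : innerSL ℝ ((-θ : Sph n) : Euc n) (‖x‖⁻¹ • x) ≠ 1 := by
    rw [hunit]
    simp
    norm_num
  have hopen : IsOpen {y : Euc n | innerSL ℝ ((-θ : Sph n) : Euc n) y ≠ 1} :=
    isOpen_ne.preimage (innerSL ℝ ((-θ : Sph n) : Euc n)).continuous
  have h2 : ContDiffAt ℝ 2 (stereoToFun ((-θ : Sph n) : Euc n)) (‖x‖⁻¹ • x) :=
    contDiffOn_stereoToFun.contDiffAt (hopen.mem_nhds hsub)
  have h3 : ContDiffAt ℝ 2 (fun y : Euc n => tangentIsometry θ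
      (stereoToFun ((-θ : Sph n) : Euc n) (‖y‖⁻¹ • y))) x :=
    (tangentIsometry θ).contDiff.contDiffAt.comp x
      (ContDiffAt.comp (f := fun y : Euc n => ‖y‖⁻¹ • y) x h2 h1)
  have h4 : tangentIsometry θ (stereoToFun ((-θ : Sph n) : Euc n) (‖x‖⁻¹ • x)) = 0 := by
    rw [hunit, ← chartAt_apply, chartAt_self]
  have h5 := (contDiffAt_comp_chartAt_symm (hf θ)).of_le (m := 2) (by norm_cast)
  rw [← h4] at h5
  refine (h5.comp x h3).congr_of_eventuallyEq ?_
  filter_upwards [isOpen_ne.mem_nhds hx, h1.continuousAt.eventually (hopen.mem_nhds hsub)]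
    with y hy hy'
  obtain ⟨η, hη⟩ := exists_eq_norm_smul hy
  have hunit' : ‖y‖⁻¹ • y = (η : Euc n) := by
    conv_lhs => rw [hη]
    simp [norm_smul, smul_smul, hy]
  rw [hunit'] at hy'
  have hsource : η ∈ (chartAt (EuclideanSpace ℝ (Fin n)) θ).source := by
    change η ∈ (stereographic' n (-θ)).source
    rw [stereographic'_source]
    rintro rfl
    simp at hy'
  simp only [Function.comp_apply, hunit']
  rw [← chartAt_apply, OpenPartialHomeomorph.left_inv _ hsource, ← radialExt_coe f η, ← hunit',
    radialExt_smul_eq _ _ (by positivity)]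

theorem fderiv_radialExt_self (f : Sph n → ℝ) (θ : Sph n)
    (hf : DifferentiableAt ℝ (radialExt f) (θ : Euc n)) :
    fderiv ℝ (radialExt f) (θ : Euc n) (θ : Euc n) = 0 := by
  have h1 : HasDerivAt (fun t : ℝ => t • (θ : Euc n)) (θ : Euc n) 1 := by
    have := (hasDerivAt_id (1 : ℝ)).smul_const (θ : Euc n)
    rwa [one_smul] at this
  have h2 : HasFDerivAt (radialExt f) (fderiv ℝ (radialExt f) (θ : Euc n))
      ((1 : ℝ) • (θ : Euc n)) := by
    rw [one_smul]; exact hf.hasFDerivAt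
  have h3 := h2.comp_hasDerivAt 1 h1
  have h4 : (radialExt f ∘ fun t : ℝ => t • (θ : Euc n)) =ᶠ[𝓝 1] fun _ => f θ := by
    filter_upwards [Ioi_mem_nhds one_pos] with t ht
    exact radialExt_smul f θ ht
  exact h3.unique ((hasDerivAt_const _ _).congr_of_eventuallyEq h4)

/-- The equivalence between the model space and the orthogonal complement of `θ` given by the
derivative of the inverse of the preferred chart at `θ`. -/
def tangentEquiv (θ : Sph n) : EuclideanSpace ℝ (Fin n) ≃ₗ[ℝ] (ℝ ∙ (θ : Euc n))ᗮ :=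
  (tangentIsometry θ).symm.toLinearEquiv.trans
    (LinearEquiv.ofEq _ _ (by
      rw [show ((-θ : Sph n) : Euc n) = -(θ : Euc n) from rfl, ← Set.neg_singleton,
        Submodule.span_neg]))

theorem fderiv_sphereParam (θ : Sph n) (v : EuclideanSpace ℝ (Fin n)) :
    fderiv ℝ (sphereParam θ) 0 v = (tangentEquiv θ v : Euc n) := by
  rw [(hasFDerivAt_sphereParam θ).fderiv]
  rfl

theorem mfderiv_eq_zero_iff {f : Sph n → ℝ} (hf : SmoothOnSph f) (θ : Sph n) :
    mfderiv (𝓡 n) 𝓘(ℝ, ℝ) f θ = 0 ↔ fderiv ℝ (radialExt f) (θ : Euc n) = 0 := by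
  have hθ : (θ : Euc n) ≠ 0 := ne_zero_of_mem_unit_sphere θ
  have hd : DifferentiableAt ℝ (radialExt f) (θ : Euc n) :=
    (contDiffAt_radialExt hf hθ).differentiableAt (by simp)
  have h1 : mfderiv (𝓡 n) 𝓘(ℝ, ℝ) f θ =
      fderiv ℝ (f ∘ (chartAt (EuclideanSpace ℝ (Fin n)) θ).symm) 0 := by
    rw [((hf θ).mdifferentiableAt (by simp)).mfderiv]
    simp [writtenInExtChartAt, Function.comp_def, chartAt_self_eq]
    rfl
  have h2 : fderiv ℝ (f ∘ (chartAt (EuclideanSpace ℝ (Fin n)) θ).symm) 0 =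
      (fderiv ℝ (radialExt f) (θ : Euc n)).comp (fderiv ℝ (sphereParam θ) 0) := by
    rw [comp_chartAt_symm, fderiv_comp, sphereParam_zero]
    · rwa [sphereParam_zero]
    · exact (hasFDerivAt_sphereParam θ).differentiableAt
  refine (Eq.congr_left (h1.trans h2)).trans ⟨fun h => ?_, fun h => ?_⟩
  · have hperp : ∀ w : (ℝ ∙ (θ : Euc n))ᗮ, fderiv ℝ (radialExt f) (θ : Euc n) w = 0 := by
      intro w
      obtain ⟨v, rfl⟩ := (tangentEquiv θ).surjective w
      rw [← fderiv_sphereParam]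
      exact congrArg (fun L => L v) h
    ext x
    -- Only the tangential part of `x` matters, since the extension is constant along rays.
    have hx : x - inner ℝ (θ : Euc n) x • (θ : Euc n) ∈ (ℝ ∙ (θ : Euc n))ᗮ := by
      rw [Submodule.mem_orthogonal_singleton_iff_inner_right, inner_sub_right,
        real_inner_smul_right, real_inner_self_eq_norm_sq, norm_eq_of_mem_sphere]
      ring
    have h3 := hperp ⟨_, hx⟩
    simp only [map_sub, map_smul, fderiv_radialExt_self f θ hd] at h3
    simpa using h3
  · rw [h]
    exact ContinuousLinearMap.zero_comp _

/-- The Hessian in the preferred chart, as a bilinear form. -/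
def chartHessian (f : Sph n → ℝ) (θ : Sph n) :
    LinearMap.BilinForm ℝ (EuclideanSpace ℝ (Fin n)) :=
  LinearMap.mk₂ ℝ (hessianAt f θ) (by simp [hessianAt]) (by simp [hessianAt])
    (by simp [hessianAt]) (by simp [hessianAt])

theorem chartHessian_apply {f : Sph n → ℝ} (hf : SmoothOnSph f) {θ : Sph n}
    (hc : fderiv ℝ (radialExt f) (θ : Euc n) = 0) (v w : EuclideanSpace ℝ (Fin n)) :
    chartHessian f θ v w =
      tangentHessian (radialExt f) (θ : Euc n) (tangentEquiv θ v) (tangentEquiv θ w) := by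
  change hessianAt f θ v w = _
  have hF : ContDiffAt ℝ 2 (radialExt f) (sphereParam θ 0) :=
    contDiffAt_radialExt hf (by rw [sphereParam_zero]; exact ne_zero_of_mem_unit_sphere θ)
  rw [hessianAt, comp_chartAt_symm, chartAt_self,
    fderiv_fderiv_comp hF (contDiff_sphereParam θ).contDiffAt, sphereParam_zero, hc,
    fderiv_sphereParam, fderiv_sphereParam]
  simp

/-- Non-degenerate critical points in terms of the extension to the ambient space. -/
theorem isNondegCritWithIndex_iff {f : Sph n → ℝ} (hf : SmoothOnSph f) (θ : Sph n) (i : ℕ) :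
    IsNondegCritWithIndex f θ i ↔ fderiv ℝ (radialExt f) (θ : Euc n) = 0 ∧
      NondegWithIndex (tangentHessian (radialExt f) (θ : Euc n)) i := by
  have h1 : IsNondegCritWithIndex f θ i ↔
      mfderiv (𝓡 n) 𝓘(ℝ, ℝ) f θ = 0 ∧ NondegWithIndex (chartHessian f θ) i :=
    ⟨fun h => ⟨h.critical, h.nondegenerate, h.index⟩, fun h => ⟨hf θ, h.1, h.2.1, h.2.2⟩⟩
  rw [h1, mfderiv_eq_zero_iff hf]
  refine and_congr_right fun hc => ?_
  exact nondegWithIndex_equiv_iff (tangentEquiv θ) one_pos fun v w => by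
    rw [chartHessian_apply hf hc, one_mul]

theorem radialExt_hatFun (f : Sph n → ℝ) {x : Euc n} (hx : x ≠ 0) :
    radialExt (hatFun f) x = (radialExt f (-x))⁻¹ := by
  obtain ⟨θ, hθ⟩ := exists_eq_norm_smul hx
  have h1 : -x = ‖x‖ • ((-θ : Sph n) : Euc n) := by
    conv_lhs => rw [hθ]
    simp
  rw [h1, radialExt_smul _ _ (norm_pos_iff.2 hx)]
  conv_lhs => rw [hθ]
  rw [radialExt_smul _ _ (norm_pos_iff.2 hx), hatFun, one_div]

theorem SmoothOnSph.hatFun {f : Sph n → ℝ} (hf : SmoothOnSph f) (hpos : ∀ θ, 0 < f θ) :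
    SmoothOnSph (hatFun f) := by
  intro θ
  have h1 : ContMDiffAt (𝓡 n) 𝓘(ℝ, ℝ) ∞ (fun η : Sph n => f (-η)) θ :=
    (ContMDiff.comp hf contMDiff_neg_sphere) θ
  have h2 : ContMDiffAt 𝓘(ℝ, ℝ) 𝓘(ℝ, ℝ) ∞ (fun t : ℝ => 1 / t) (f (-θ)) := by
    simp only [one_div]
    exact (contDiffAt_inv ℝ (hpos _).ne').contMDiffAt
  exact h2.comp θ h1

theorem isNondegCritWithIndex_hatFun_iff {f : Sph n → ℝ} (hf : SmoothOnSph f)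
    (hpos : ∀ θ, 0 < f θ) (θ : Sph n) {i : ℕ} (hi : i ≤ n) :
    IsNondegCritWithIndex f θ i ↔ IsNondegCritWithIndex (hatFun f) (-θ) (n - i) := by
  have hθ : ((-θ : Sph n) : Euc n) ≠ 0 := ne_zero_of_mem_unit_sphere (-θ)
  have hneg : -((-θ : Sph n) : Euc n) = θ := neg_neg (θ : Euc n)
  have hF : ContDiffAt ℝ 2 (radialExt f) (-((-θ : Sph n) : Euc n)) :=
    contDiffAt_radialExt hf (neg_ne_zero.2 hθ)
  have hid : ContDiffAt ℝ 2 (fun x : Euc n => -x) ((-θ : Sph n) : Euc n) := contDiffAt_id.neg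
  have hFn : ContDiffAt ℝ 2 (fun x : Euc n => radialExt f (-x)) ((-θ : Sph n) : Euc n) :=
    hF.comp _ hid
  have hne : radialExt f (-((-θ : Sph n) : Euc n)) ≠ 0 := by
    rw [hneg, radialExt_coe]; exact (hpos θ).ne'
  have heq : radialExt (hatFun f) =ᶠ[𝓝 ((-θ : Sph n) : Euc n)] fun x => (radialExt f (-x))⁻¹ := by
    filter_upwards [isOpen_ne.mem_nhds hθ] with x hx
    exact radialExt_hatFun f hx
  have hcn : fderiv ℝ (fun x : Euc n => radialExt f (-x)) ((-θ : Sph n) : Euc n) =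
      -fderiv ℝ (radialExt f) (θ : Euc n) := by
    have h1 := (hF.differentiableAt (by simp)).hasFDerivAt.comp ((-θ : Sph n) : Euc n)
      (hasFDerivAt_id ((-θ : Sph n) : Euc n)).neg
    refine h1.fderiv.trans ?_
    rw [hneg]
    ext v
    simp
  have hnn : fderiv ℝ (fun x : Euc n => -x) = fun _ => -ContinuousLinearMap.id ℝ (Euc n) := by
    ext x : 1
    exact (hasFDerivAt_id x).neg.fderiv
  have hcrit : fderiv ℝ (radialExt (hatFun f)) ((-θ : Sph n) : Euc n) = 0 ↔
      fderiv ℝ (radialExt f) (θ : Euc n) = 0 := by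
    rw [heq.fderiv_eq, fderiv_inv_eq_zero_iff hFn hne, hcn, neg_eq_zero]
  rw [isNondegCritWithIndex_iff hf, isNondegCritWithIndex_iff (hf.hatFun hpos), hcrit]
  refine and_congr_right fun hc => ?_
  have hrank : Module.finrank ℝ (ℝ ∙ (θ : Euc n))ᗮ = n := by
    rw [← (tangentEquiv θ).finrank_eq]; simp
  have hF' : ContDiffAt ℝ 2 (radialExt f) (θ : Euc n) := by rwa [hneg] at hF
  rw [nondegWithIndex_neg_iff (tangentHessian_symm hF') (by rw [hrank]; exact hi), hrank]
  have hspan : (ℝ ∙ ((-θ : Sph n) : Euc n))ᗮ = (ℝ ∙ (θ : Euc n))ᗮ := by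
    rw [show ((-θ : Sph n) : Euc n) = -(θ : Euc n) from rfl, ← Set.neg_singleton,
      Submodule.span_neg]
  -- At a critical point the Hessian of `1 / f(-x)` at `-θ` is `-(f θ)⁻²` times that of `f` at `θ`.
  refine (nondegWithIndex_equiv_iff (LinearEquiv.ofEq _ _ hspan) (c := (f θ)⁻¹ ^ 2)
    (by have := hpos θ; positivity) fun v w => ?_).symm
  have h2 := fderiv_fderiv_comp (G := radialExt f) hF hid (v : Euc n) (w : Euc n)
  rw [tangentHessian_apply, heq.fderiv.fderiv_eq,
    fderiv_fderiv_inv hFn hne (by rw [hcn, hc, neg_zero])]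
  simp only [Function.comp_def, hnn, hneg, hc] at h2
  have hcoe : ∀ u, ((LinearEquiv.ofEq _ _ hspan u : (ℝ ∙ (θ : Euc n))ᗮ) : Euc n) = u :=
    fun _ => rfl
  rw [h2, hneg, radialExt_coe, LinearMap.neg_apply, LinearMap.neg_apply, tangentHessian_apply,
    hcoe, hcoe]
  simp

end Sphere

/-! ### The Wulff shape: support function, gauge and polarity. -/

section WulffShape

variable {n : ℕ}

theorem polarInv_image_polarGraph {γ : Sph n → ℝ} (hpos : ∀ θ, 0 < γ θ) :
    polarInv '' polarGraph γ = Set.range fun θ : Sph n => (γ θ)⁻¹ • -(θ : Euc n) := by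
  rw [polarGraph, ← Set.range_comp]
  congr 1
  ext1 θ
  have := (hpos θ).ne'
  simp [polarInv, norm_smul, abs_of_pos (hpos θ), smul_smul, this]

theorem mem_wulffShape {γ : Sph n → ℝ} {x : Euc n} :
    x ∈ wulffShape γ ↔ ∀ θ : Sph n, inner ℝ x (θ : Euc n) ≤ γ θ := by
  simp [wulffShape]

theorem isClosed_wulffShape (γ : Sph n → ℝ) : IsClosed (wulffShape γ) :=
  isClosed_iInter fun _ => isClosed_le (by fun_prop) continuous_const

/-- Every boundary point of the Wulff shape lies on one of its defining hyperplanes. -/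
theorem exists_inner_eq_of_mem_frontier {γ : Sph n → ℝ} (hγ : Continuous γ) {p : Euc n}
    (hp : p ∈ frontier (wulffShape γ)) : ∃ θ : Sph n, inner ℝ p (θ : Euc n) = γ θ := by
  have hpW := mem_wulffShape.1 ((isClosed_wulffShape γ).frontier_subset hp)
  by_contra! hne
  have hne' : Nonempty (Sph n) := (NormedSpace.sphere_nonempty.2 zero_le_one).to_subtype
  obtain ⟨θ, -, hθ⟩ := isCompact_univ.exists_isMinOn (Set.univ_nonempty (α := Sph n))
    (f := fun θ : Sph n => γ θ - inner ℝ p (θ : Euc n)) (by fun_prop)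
  -- The least slack is positive; as the normals are unit vectors, a ball of that radius about `p`
  -- stays inside the Wulff shape.
  have hm : 0 < γ θ - inner ℝ p (θ : Euc n) := sub_pos.2 (lt_of_le_of_ne (hpW θ) (hne θ))
  refine hp.2 (mem_interior.2 ⟨Metric.ball p _, fun y hy => ?_, Metric.isOpen_ball,
    Metric.mem_ball_self hm⟩)
  rw [mem_wulffShape]
  intro η
  have h1 : γ θ - inner ℝ p (θ : Euc n) ≤ γ η - inner ℝ p (η : Euc n) := hθ (Set.mem_univ η)
  have h2 : inner ℝ (y - p) (η : Euc n) ≤ ‖y - p‖ * ‖(η : Euc n)‖ := real_inner_le_norm _ _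
  rw [norm_eq_of_mem_sphere, mul_one, inner_sub_left] at h2
  rw [mem_ball_iff_norm] at hy
  linarith

/-- A convex integrand is the support function of its Wulff shape. -/
theorem IsConvexIntegrand.exists_mem_wulffShape {γ : Sph n → ℝ} (hγ : IsConvexIntegrand γ)
    (θ : Sph n) : ∃ x ∈ wulffShape γ, inner ℝ x (θ : Euc n) = γ θ := by
  have hfr := hγ.frontier_eq
  rw [polarInv_image_polarGraph hγ.pos] at hfr
  set S : Set (Euc n) := Set.range fun θ : Sph n => (γ θ)⁻¹ • -(θ : Euc n) with hS
  have hmem : ∀ η : Sph n, (γ η)⁻¹ • -(η : Euc n) ∈ S := fun η => ⟨η, rfl⟩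
  have hconv := convex_convexHull ℝ S
  -- The origin lies between the points of `S` in directions `±θ`, and it is not on the frontier,
  -- which is `S`.
  have h0 : (0 : Euc n) ∈ interior (convexHull ℝ S) := by
    have h1 : (0 : Euc n) ∈ convexHull ℝ S := by
      have hp := inv_pos.2 (hγ.pos θ)
      have hq := inv_pos.2 (hγ.pos (-θ))
      have h2 := hconv (subset_convexHull ℝ S (hmem θ)) (subset_convexHull ℝ S (hmem (-θ)))
        (a := (γ (-θ))⁻¹ / ((γ θ)⁻¹ + (γ (-θ))⁻¹)) (b := (γ θ)⁻¹ / ((γ θ)⁻¹ + (γ (-θ))⁻¹))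
        (by positivity) (by positivity) (by rw [← add_div, add_comm, div_self (add_pos hp hq).ne'])
      convert h2 using 1
      rw [show ((-θ : Sph n) : Euc n) = -(θ : Euc n) from rfl]
      match_scalars
      ring
    by_contra h2
    have h3 : (0 : Euc n) ∈ frontier (convexHull ℝ S) := ⟨subset_closure h1, h2⟩
    rw [hfr] at h3
    obtain ⟨η, hη⟩ := h3
    have := (hγ.pos η).ne'
    simp [this] at hη
    exact ne_zero_of_mem_unit_sphere η hη
  have hp : (γ θ)⁻¹ • -(θ : Euc n) ∉ interior (convexHull ℝ S) := by
    have := hmem θ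
    rw [← hfr] at this
    exact this.2
  -- A supporting hyperplane of the hull at its boundary point in direction `-θ`; its rescaled
  -- normal is the required point of the Wulff shape.
  obtain ⟨f, hf⟩ := geometric_hahn_banach_open_point hconv.interior isOpen_interior hp
  have hle : ∀ y ∈ S, f y ≤ f ((γ θ)⁻¹ • -(θ : Euc n)) := by
    intro y hy
    have hy' : y ∈ closure (interior (convexHull ℝ S)) := by
      rw [hconv.closure_interior_eq_closure_of_nonempty_interior ⟨0, h0⟩]
      exact subset_closure (subset_convexHull ℝ S hy)
    exact closure_minimal (fun a ha => (hf a ha).le)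
      (isClosed_le f.continuous continuous_const) hy'
  have hpos := hf 0 h0
  rw [map_zero] at hpos
  set c := f ((γ θ)⁻¹ • -(θ : Euc n)) with hcdef
  have hin : ∀ η : Sph n, inner ℝ (-(c⁻¹ • (InnerProductSpace.toDual ℝ (Euc n)).symm f)) (η : Euc n)
      = c⁻¹ * f ((γ η)⁻¹ • -(η : Euc n)) * γ η := by
    intro η
    have := (hγ.pos η).ne'
    rw [inner_neg_left, real_inner_smul_left, InnerProductSpace.toDual_symm_apply]
    simp
    field_simp
  -- Dividing by `c` normalises the functional to `1` at the touching point, so `f ≤ c` on `S`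
  -- becomes `⟪x, η⟫ ≤ γ η`, with equality at `θ`.
  refine ⟨-(c⁻¹ • (InnerProductSpace.toDual ℝ (Euc n)).symm f),
    mem_wulffShape.2 fun η => ?_, ?_⟩
  · rw [hin]
    have h1 : c⁻¹ * f ((γ η)⁻¹ • -(η : Euc n)) ≤ 1 := by
      rw [inv_mul_le_iff₀ hpos, mul_one]
      exact hle _ (hmem η)
    nlinarith [hγ.pos η]
  · rw [hin, ← hcdef, inv_mul_cancel₀ hpos.ne', one_mul]

theorem norm_mul_radialExt_smul (f : Sph n → ℝ) (θ : Sph n) {r : ℝ} (hr : 0 < r) :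
    ‖r • (θ : Euc n)‖ * radialExt f (r • (θ : Euc n)) = r * f θ := by
  rw [radialExt_smul f θ hr, norm_smul, norm_eq_of_mem_sphere, mul_one, Real.norm_of_nonneg hr.le]

theorem norm_mul_inv_radialExt_smul (f : Sph n → ℝ) (θ : Sph n) {r : ℝ} (hr : 0 < r) :
    ‖r • (θ : Euc n)‖ * (radialExt (hatFun f) (r • (θ : Euc n)))⁻¹ = r * f (-θ) := by
  rw [radialExt_smul _ θ hr, norm_smul, norm_eq_of_mem_sphere, mul_one, Real.norm_of_nonneg hr.le,
    hatFun, one_div, inv_inv]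

/-- The sign change in the inversion is why the gauge of the Wulff shape at `θ` is `δ (-θ)`. -/
theorem IsDualIntegrand.mem_frontier {γ δ : Sph n → ℝ} (h : IsDualIntegrand γ δ) (θ : Sph n) :
    (δ (-θ))⁻¹ • (θ : Euc n) ∈ frontier (wulffShape γ) := by
  rw [← h.inv_graph_eq, polarInv_image_polarGraph h.isConvexIntegrand.pos]
  exact ⟨-θ, by simp⟩

/-- The homogeneous extensions of a smooth convex integrand and of the inverse of the radial
function of its Wulff shape are mutually polar. -/
theorem IsDualIntegrand.dualPair {γ δ : Sph n → ℝ} (h : IsDualIntegrand γ δ)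
    (hγ : IsConvexIntegrand γ) (hγs : SmoothOnSph γ) (hδs : SmoothOnSph δ) :
    DualPair (fun x : Euc n => ‖x‖ * radialExt γ x)
      (fun x => ‖x‖ * (radialExt (hatFun δ) x)⁻¹) := by
  have hδ := h.isConvexIntegrand
  have hle : ∀ θ η : Sph n, inner ℝ (θ : Euc n) (η : Euc n) ≤ δ (-θ) * γ η := by
    intro θ η
    have h1 := mem_wulffShape.1 ((isClosed_wulffShape γ).frontier_subset (h.mem_frontier θ)) η
    rwa [real_inner_smul_left, inv_mul_le_iff₀ (hδ.pos _)] at h1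
  have hleft : ∀ θ : Sph n, ∃ η : Sph n, inner ℝ (θ : Euc n) (η : Euc n) = δ (-θ) * γ η := by
    intro θ
    obtain ⟨η, hη⟩ := exists_inner_eq_of_mem_frontier hγ.continuous (h.mem_frontier θ)
    refine ⟨η, ?_⟩
    rw [real_inner_smul_left] at hη
    rw [← hη, mul_inv_cancel_left₀ (hδ.pos _).ne']
  have hright : ∀ η : Sph n, ∃ θ : Sph n, inner ℝ (θ : Euc n) (η : Euc n) = δ (-θ) * γ η := by
    intro η
    obtain ⟨x, hx, hxη⟩ := hγ.exists_mem_wulffShape η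
    have hx0 : x ≠ 0 := by
      rintro rfl
      rw [inner_zero_left] at hxη
      exact (hγ.pos η).ne hxη
    obtain ⟨θ, r, hn, rfl⟩ := exists_eq_pos_smul hx0
    -- The constraint at a partner `ζ` of `θ` bounds the length of `r θ` in the Wulff shape by `1 /
    -- δ (-θ)`. So the boundary point in direction `θ` attains `γ η` as well.
    obtain ⟨ζ, hζ⟩ := hleft θ
    have h1 := mem_wulffShape.1 hx ζ
    rw [real_inner_smul_left, hζ] at h1
    rw [real_inner_smul_left] at hxη
    refine ⟨θ, le_antisymm (hle θ η) ?_⟩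
    have h2 : r * δ (-θ) ≤ 1 := by nlinarith [hγ.pos ζ]
    have h3 : r * (δ (-θ) * γ η) ≤ r * inner ℝ (θ : Euc n) (η : Euc n) := by
      rw [hxη]; nlinarith [hγ.pos η]
    exact le_of_mul_le_mul_left h3 hn
  have hpos : ∀ f : Sph n → ℝ, (∀ θ, 0 < f θ) → ∀ x : Euc n, x ≠ 0 → 0 < radialExt f x := by
    intro f hf x hx
    obtain ⟨θ, r, hr, rfl⟩ := exists_eq_pos_smul hx
    rw [radialExt_smul f θ hr]
    exact hf θ
  have hhat : ∀ θ, 0 < hatFun δ θ := fun θ => one_div_pos.2 (hδ.pos _)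
  refine ⟨fun x hx => ?_, fun x hx => ?_, fun t x ht => ?_, fun t x ht => ?_, fun x hx => ?_,
    fun x hx => ?_, fun x u => ?_, fun x hx => ?_, fun u hu => ?_⟩
  · exact mul_pos (norm_pos_iff.2 hx) (hpos γ hγ.pos x hx)
  · exact mul_pos (norm_pos_iff.2 hx) (inv_pos.2 (hpos _ hhat x hx))
  · simp only [radialExt_smul_eq _ _ ht, norm_smul, Real.norm_of_nonneg ht.le, mul_assoc]
  · simp only [radialExt_smul_eq _ _ ht, norm_smul, Real.norm_of_nonneg ht.le, mul_assoc]
  · exact (contDiffAt_norm ℝ hx).mul (contDiffAt_radialExt hγs hx)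
  · exact (contDiffAt_norm ℝ hx).mul
      ((contDiffAt_radialExt (hδs.hatFun hδ.pos) hx).inv (hpos _ hhat x hx).ne')
  · rcases eq_or_ne x 0 with rfl | hx
    · simp
    rcases eq_or_ne u 0 with rfl | hu
    · simp
    obtain ⟨θ, r, hx', rfl⟩ := exists_eq_pos_smul hx
    obtain ⟨η, s, hu', rfl⟩ := exists_eq_pos_smul hu
    simp only [norm_mul_inv_radialExt_smul δ θ hx', norm_mul_radialExt_smul γ η hu',
      real_inner_smul_left, real_inner_smul_right]
    calc s * (r * inner ℝ (θ : Euc n) (η : Euc n))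
        = (r * s) * inner ℝ (θ : Euc n) (η : Euc n) := by ring
      _ ≤ (r * s) * (δ (-θ) * γ η) := mul_le_mul_of_nonneg_left (hle θ η) (by positivity)
      _ = r * δ (-θ) * (s * γ η) := by ring
  · obtain ⟨θ, r, hx', rfl⟩ := exists_eq_pos_smul hx
    obtain ⟨η, hη⟩ := hleft θ
    refine ⟨(1 : ℝ) • (η : Euc n), by simpa using ne_zero_of_mem_unit_sphere η, ?_⟩
    simp only [norm_mul_inv_radialExt_smul δ θ hx', norm_mul_radialExt_smul γ η one_pos,
      real_inner_smul_left, real_inner_smul_right, hη]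
    ring
  · obtain ⟨η, s, hu', rfl⟩ := exists_eq_pos_smul hu
    obtain ⟨θ, hθ⟩ := hright η
    refine ⟨(1 : ℝ) • (θ : Euc n), by simpa using ne_zero_of_mem_unit_sphere θ, ?_⟩
    simp only [norm_mul_inv_radialExt_smul δ θ one_pos, norm_mul_radialExt_smul γ η hu',
      real_inner_smul_left, real_inner_smul_right, hθ]
    ring

end WulffShape

end

theorem corollary3 (n : ℕ) (hn : 0 < n) (γ δ : Sph n → ℝ)
    (hγ : IsConvexIntegrand γ) (hstable : IsStable γ)
    (hdual : IsDualIntegrand γ δ) (hδ : SmoothOnSph δ)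
    (θ₀ : Sph n) (i : ℕ) (hi : i ≤ n) :
    [IsNondegCritWithIndex γ θ₀ i,
      IsNondegCritWithIndex δ (-θ₀) (n - i),
      IsNondegCritWithIndex (hatFun γ) (-θ₀) (n - i),
      IsNondegCritWithIndex (hatFun δ) θ₀ i].TFAE := by
  obtain ⟨⟨hγs, -⟩, -⟩ := hstable
  have hδpos := hdual.isConvexIntegrand.pos
  have hθ : ((θ₀ : Sph n) : Euc n) ≠ 0 := ne_zero_of_mem_unit_sphere θ₀
  have hδhat := hδ.hatFun hδpos
  tfae_have 1 ↔ 3 := isNondegCritWithIndex_hatFun_iff hγs hγ.pos θ₀ hi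
  tfae_have 2 ↔ 4 := by
    -- Taken at `-θ₀` with index `n - i`; the bound `i ≤ n` makes the truncated `n - (n - i)` equal
    -- to `i`.
    have := isNondegCritWithIndex_hatFun_iff hδ hδpos (-θ₀) (Nat.sub_le n i)
    rwa [neg_neg, Nat.sub_sub_self hi] at this
  tfae_have 1 ↔ 4 := by
    rw [isNondegCritWithIndex_iff hγs, isNondegCritWithIndex_iff hδhat]
    exact (hdual.dualPair hγ hγs hδ).crit_nondegWithIndex_iff (norm_eq_of_mem_sphere θ₀)
      (contDiffAt_radialExt hγs hθ) (contDiffAt_radialExt hδhat hθ)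
  tfae_finish
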